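/- \textbf{Setting.} Consider $N\ge 1$ identical agents $\dot x_i=Ax_i+B\nu_i$, $\eta_i=Cx_i$ with $A\in\mathbb R^{n\times n}$, $B\in\mathbb R^{n\times m}$, $C\in\mathbb R^{m\times n}$, whose realization is minimal (controllable and observable) and passive. Passivity means that there are symmetric positive definite matrices $K$ with $$A^\top K+KA\le 0,\qquad C=B^\top K; \tag{1}$$ let $K_m$ and $K_M$ be the minimum and the maximum (in the Loewner order) of all symmetric positive definite solutions $K$ of (1). Let $L\in\mathbb R^{N\times N}$ be the Laplacian matrix of a connected undirected graph on the $N$ agents with weights $w_{ij}=w_{ji}\ge 0$, and let $F\in\mathbb R^{N\times p}$, $H\in\mathbb R^{q\times N}$. Let $$L=\begin{bmatrix}T_1&T_2\end{bmatrix}\begin{bmatrix}\Lambda&0\\0&0\end{bmatrix}\begin{bmatrix}T_1&T_2\end{bmatrix}^\top,\qquad T_2=\mathbf 1_N/\sqrt N,\quad \Lambda=\mathrm{diag}(\lambda_1,\dots,\lambda_{N-1}),\ \lambda_1\ge\dots\ge\lambda_{N-1}>0,$$ be a spectral decomposition of $L$ with $[T_1\ T_2]$ orthogonal, and put $\bar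 F=T_1^\top F$, $\bar H=HT_1$. The stable part of the network is the system $$\Sigma_s:\quad \dot z=(I_{N-1}\otimes A-\Lambda\otimes BC)z+(\bar F\otimes B)u,\qquad y=(\bar H\otimes C)z .$$ \textbf{Balanced truncation.} Let $X,Y\in\mathbb R^{(N-1)\times(N-1)}$ be symmetric positive definite with $$-\Lambda X-X\Lambda+\bar F\bar F^\top=0,\qquad -\Lambda Y-Y\Lambda+\bar H^\top\bar H\le 0,$$ where $Y$ is block diagonal along the multiplicities of the $\lambda_i$ (that is, $Y_{ij}=0$ whenever $\lambda_i\ne\lambda_j$). Let $T_{\mathcal G}$ and $T_{\mathcal D}$ be nonsingular matrices with $$T_{\mathcal G}XT_{\mathcal G}^\top=T_{\mathcal G}^{-\top}YT_{\mathcal G}^{-1}=\mathrm{diag}(\sigma_1,\dots,\sigma_{N-1}),\qquad T_{\mathcal D}K_M^{-1}T_{\mathcal D}^\top=T_{\mathcal D}^{-\top}K_mT_{\mathcal D}^{-1}=\mathrm{diag}(\tau_1,\dots,\tau_n),$$ $\sigma_1\ge\dots\ge\sigma_{N-1}$, $\tau_1\ge\dots\ge\tau_n$. Let $1\le k\le N$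 and $0\le r\le n$. Let $\hat\Lambda_1$ be the leading $(k-1)\times(k-1)$ block of $T_{\mathcal G}\Lambda T_{\mathcal G}^{-1}$, let $\hat F_1$ be the first $k-1$ rows of $T_{\mathcal G}\bar F$ and $\hat H_1$ the first $k-1$ columns of $\bar HT_{\mathcal G}^{-1}$; let $\hat A$ be the leading $r\times r$ block of $T_{\mathcal D}AT_{\mathcal D}^{-1}$, $\hat B$ the first $r$ rows of $T_{\mathcal D}B$ and $\hat C$ the first $r$ columns of $CT_{\mathcal D}^{-1}$. The reduced system is $$\hat\Sigma_s:\quad \dot{\hat z}=(I_{k-1}\otimes\hat A-\hat\Lambda_1\otimes\hat B\hat C)\hat z+(\hat F_1\otimes\hat B)u,\qquad \hat y=(\hat H_1\otimes\hat C)\hat z .$$ \textbf{Claim.} The $\mathcal H_\infty$-norm of the error (the supremum over $\mathrm{Re}\,s>0$ of the 2-induced norm of the difference of the two transfer functions) satisfies $$\|\Sigma_s-\hat\Sigma_s\|_{\mathcal H_\infty}\ \le\ 2\sum_{i=k}^{N-1}\sum_{j=1}^{n}\sigma_i\tau_j+2\sum_{i=1}^{k-1}\sum_{j=r+1}^{n}\sigma_i\tau_j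 .$$ -/

import Mathlib

open scoped Kronecker ENNReal Matrix Matrix.Norms.L2Operator

noncomputable section

/-- A triplet `(A, B, C)` of real matrices, that is, a state-space realization
`ẋ = A x + B u`, `y = C x`, with states, inputs and outputs indexed by `ι`, `μ` and `ν`. -/
structure LinSys (ι μ ν : Type*) where
  A : Matrix ι ι ℝ
  B : Matrix ι μ ℝ
  C : Matrix ν ι ℝ

namespace LinSys

variable {ι ι' μ ν : Type*}

/-- The matrix `s I - A`. -/
def charMat [DecidableEq ι] (S : LinSys ι μ ν) (s : ℂ) : Matrix ι ι ℂ :=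
  s • (1 : Matrix ι ι ℂ) - S.A.map Complex.ofReal

/-- The transfer function `C (s I - A)⁻¹ B`, meaningful where `s I - A` is invertible. -/
def transfer [Fintype ι] [DecidableEq ι] (S : LinSys ι μ ν) (s : ℂ) : Matrix ν μ ℂ :=
  S.C.map Complex.ofReal * (S.charMat s)⁻¹ * S.B.map Complex.ofReal

/-- The `H∞`-norm of the transfer function: the supremum over the open right half-plane of the
2-induced norm of `C (s I - A)⁻¹ B`. The (finitely many) eigenvalues of `A` are left out: near a
true pole the transfer function is unbounded, and at an eigenvalue that cancels it is the limit of
its values nearby. -/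
def hinfNorm [Fintype ι] [DecidableEq ι] [Fintype μ] [DecidableEq μ] [Fintype ν]
    (S : LinSys ι μ ν) : ℝ≥0∞ :=
  ⨆ (s : ℂ) (_ : 0 < s.re) (_ : IsUnit (S.charMat s)), ‖S.transfer s‖ₑ

/-- The difference `S₁ - S₂` of two systems (parallel interconnection): common input, difference of
the outputs. -/
def sub (S₁ : LinSys ι μ ν) (S₂ : LinSys ι' μ ν) : LinSys (ι ⊕ ι') μ ν where
  A := Matrix.fromBlocks S₁.A 0 0 S₂.A
  B := Matrix.fromRows S₁.B S₂.B
  C := Matrix.fromCols S₁.C (-S₂.C)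

theorem charMat_sub [DecidableEq ι] [DecidableEq ι'] (S₁ : LinSys ι μ ν) (S₂ : LinSys ι' μ ν)
    (s : ℂ) :
    (S₁.sub S₂).charMat s = Matrix.fromBlocks (S₁.charMat s) 0 0 (S₂.charMat s) := by
  ext i j
  rcases i with i | i <;> rcases j with j | j <;>
    simp [charMat, sub, Matrix.one_apply]

/-- The transfer function of the parallel interconnection is the difference of the transfer
functions. -/
theorem transfer_sub [Fintype ι] [DecidableEq ι] [Fintype ι'] [DecidableEq ι']
    (S₁ : LinSys ι μ ν) (S₂ : LinSys ι' μ ν) (s : ℂ)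
    (h₁ : IsUnit (S₁.charMat s)) (h₂ : IsUnit (S₂.charMat s)) :
    (S₁.sub S₂).transfer s = S₁.transfer s - S₂.transfer s := by
  have hB : (S₁.sub S₂).B.map Complex.ofReal
      = Matrix.fromRows (S₁.B.map Complex.ofReal) (S₂.B.map Complex.ofReal) := by
    ext i j; rcases i with i | i <;> rfl
  have hC : (S₁.sub S₂).C.map Complex.ofReal
      = Matrix.fromCols (S₁.C.map Complex.ofReal) (-(S₂.C.map Complex.ofReal)) := by
    ext i j; rcases j with j | j <;> simp [sub]
  have hA : (Matrix.fromBlocks (S₁.charMat s) 0 0 (S₂.charMat s))⁻¹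
      = Matrix.fromBlocks (S₁.charMat s)⁻¹ 0 0 (S₂.charMat s)⁻¹ := by
    rw [Matrix.inv_fromBlocks_zero₂₁_of_isUnit_iff _ _ _ (by simp [h₁, h₂])]
    simp
  rw [transfer, charMat_sub, hA, hB, hC, Matrix.fromCols_mul_fromBlocks,
    Matrix.fromCols_mul_fromRows]
  simp [transfer, sub_eq_add_neg]

/-- `(A, B)` is controllable: the columns of `B, A B, A² B, …` span the state space. -/
def IsControllable [Fintype ι] [DecidableEq ι] [Fintype μ] (S : LinSys ι μ ν) : Prop :=
  ⨆ l : ℕ, LinearMap.range (S.A ^ l * S.B).mulVecLin = ⊤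

/-- `(C, A)` is observable: the common kernel of `C, C A, C A², …` is trivial. -/
def IsObservable [Fintype ι] [DecidableEq ι] (S : LinSys ι μ ν) : Prop :=
  ∀ x : ι → ℝ, (∀ l : ℕ, (S.C * S.A ^ l) *ᵥ x = 0) → x = 0

/-- A realization is minimal if it is controllable and observable. -/
def IsMinimal [Fintype ι] [DecidableEq ι] [Fintype μ] (S : LinSys ι μ ν) : Prop :=
  S.IsControllable ∧ S.IsObservable

/-- The symmetric positive definite solutions `K` of `Aᵀ K + K A ≤ 0`, `C = Bᵀ K`; a minimal
realization is passive if and only if there is one. -/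
def kypSolutions [Fintype ι] (S : LinSys ι μ μ) : Set (Matrix ι ι ℝ) :=
  {K | K.PosDef ∧ (-(S.Aᵀ * K + K * S.A)).PosSemidef ∧ S.C = S.Bᵀ * K}

/-- The truncation to the first `l` states of the triplet `(T A T⁻¹, T B, C T⁻¹)`, which is
`(A, B, C)` in the coordinates `T x`. -/
def truncate {d : ℕ} (S : LinSys (Fin d) μ ν) (T : Matrix (Fin d) (Fin d) ℝ) {l : ℕ}
    (hl : l ≤ d) : LinSys (Fin l) μ ν where
  A := (T * S.A * T⁻¹).submatrix (Fin.castLE hl) (Fin.castLE hl)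
  B := (T * S.B).submatrix (Fin.castLE hl) id
  C := (S.C * T⁻¹).submatrix id (Fin.castLE hl)

/-- The networked system `ż = (I ⊗ A - Λ ⊗ B C) z + (F ⊗ B) u`, `y = (H ⊗ C) z` built from a
network triplet `G = (Λ, F, H)` and an agent `D = (A, B, C)`. -/
def networked {ι δ π ο μ : Type*} [DecidableEq ι] [Fintype μ]
    (G : LinSys ι π ο) (D : LinSys δ μ μ) : LinSys (ι × δ) (π × μ) (ο × μ) where
  A := (1 : Matrix ι ι ℝ) ⊗ₖ D.A - G.A ⊗ₖ (D.B * D.C)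
  B := G.B ⊗ₖ D.B
  C := G.C ⊗ₖ D.C

end LinSys

/-- `w` is the weight function of an undirected connected weighted graph on `N` nodes: nodes
`i ≠ j` are adjacent when `w i j > 0`. -/
def IsConnectedWeight {N : ℕ} (w : Fin N → Fin N → ℝ) : Prop :=
  (∀ i j, 0 ≤ w i j) ∧ (∀ i j, w i j = w j i) ∧
    (SimpleGraph.fromRel fun i j => 0 < w i j).Connected

/-- The Laplacian matrix of the graph with weights `w`. -/
def weightedLaplacian {N : ℕ} (w : Fin N → Fin N → ℝ) : Matrix (Fin N) (Fin N) ℝ :=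
  Matrix.of fun i j => if i = j then ∑ l ∈ Finset.univ.erase i, w i l else -w i j

/-- The column `T₂ = 1_N / √N`. -/
def averageCol (N : ℕ) : Matrix (Fin N) Unit ℝ :=
  Matrix.of fun _ _ => 1 / Real.sqrt N

/-- The spectral decomposition `L = [T₁ T₂] diag(Λ, 0) [T₁ T₂]ᵀ` with `[T₁ T₂]` orthogonal,
`T₂ = 1_N / √N` and `Λ = diag lam`, where `lam` lists the nonzero eigenvalues of `L` in
non-increasing order. -/
def IsSpectralDecomp {N : ℕ} (L : Matrix (Fin N) (Fin N) ℝ)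
    (T₁ : Matrix (Fin N) (Fin (N - 1)) ℝ) (lam : Fin (N - 1) → ℝ) : Prop :=
  (Matrix.fromCols T₁ (averageCol N))ᵀ * Matrix.fromCols T₁ (averageCol N) = 1 ∧
  Matrix.fromCols T₁ (averageCol N) * (Matrix.fromCols T₁ (averageCol N))ᵀ = 1 ∧
  L = Matrix.fromCols T₁ (averageCol N) *
      (Matrix.fromBlocks (Matrix.diagonal lam) 0 0 0 :
        Matrix (Fin (N - 1) ⊕ Unit) (Fin (N - 1) ⊕ Unit) ℝ) * (Matrix.fromCols T₁ (averageCol N))ᵀ ∧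
  Antitone lam ∧ ∀ i, 0 < lam i

/-- `T` is nonsingular and balances the pair `(P, Q)`:
`T P Tᵀ = T⁻ᵀ Q T⁻¹ = diag σ` with `σ` non-increasing. -/
def IsBalancing {d : ℕ} (T P Q : Matrix (Fin d) (Fin d) ℝ) (σ : Fin d → ℝ) : Prop :=
  IsUnit T ∧ T * P * Tᵀ = Matrix.diagonal σ ∧ (T⁻¹)ᵀ * Q * T⁻¹ = Matrix.diagonal σ ∧ Antitone σ

/-- `Y` is block diagonal along the multiplicities of the entries of `lam` (a monotone list), i.e.
it has no entry that links two different values of `lam`. -/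
def IsBlockDiagAlong {d : ℕ} (lam : Fin d → ℝ) (Y : Matrix (Fin d) (Fin d) ℝ) : Prop :=
  ∀ i j, lam i ≠ lam j → Y i j = 0

/-- The network triplet `(Λ, T₁ᵀ F, H T₁)` of the stable part. -/
def stableTriplet {N p q : ℕ} (T₁ : Matrix (Fin N) (Fin (N - 1)) ℝ) (lam : Fin (N - 1) → ℝ)
    (F : Matrix (Fin N) (Fin p) ℝ) (H : Matrix (Fin q) (Fin N) ℝ) :
    LinSys (Fin (N - 1)) (Fin p) (Fin q) where
  A := Matrix.diagonal lam
  B := T₁ᵀ * F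
  C := H * T₁

/-- The a priori bound `2 ∑_{i ≥ k} ∑_j σ_i τ_j + 2 ∑_{i < k} ∑_{j > r} σ_i τ_j`, where the
1-based index of `i : Fin _` is `i + 1`. -/
def errBound {M n : ℕ} (k r : ℕ) (σ : Fin M → ℝ) (τ : Fin n → ℝ) : ℝ :=
  2 * ∑ i : Fin M with k ≤ i.val + 1, ∑ j, σ i * τ j +
    2 * ∑ i : Fin M with i.val + 1 < k, ∑ j : Fin n with r < j.val + 1, σ i * τ j

end

/-! ### Gramian inequalities as energy estimates at a complex frequency -/

namespace LinSys

variable {ι κ μ ν : Type*} [Fintype ι] [Fintype μ] [Fintype ν]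

/-! In balanced coordinates `diag (σ i * τ j)` is both a generalized controllability and a
generalized observability Gramian of the networked system (`networked_isBalanced`). Passivity makes
this work: `C K⁻¹ = Bᵀ` and `C = Bᵀ K` turn the coupling `Λ ⊗ BC` into the network Lyapunov
expression tensored with `B Bᵀ` or `Cᵀ C`, so each inequality is a sum of two Kronecker products of
semidefinite matrices.

For any system with diagonal Gramian `d`, deleting one state `a` moves the output by at most `2 * d
a * ‖u‖` (`sum_sq_output_sub_le`). With `x` and `z` the states before and after deletion, the
observability inequality is applied to `x - z` and the controllability inequality to `x + z` with
input `2u`; both leave the same cross term at `a`, which is eliminated. Deleting states one at a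
time and adding the errors gives twice the sum of the discarded `d`. The reduced network keeps a
product set of index pairs, and the discarded pairs form the two sums of the bound. -/

theorem re_map_ofReal_mulVec {α β : Type*} [Fintype β] (M : Matrix α β ℝ) (x : β → ℂ) (i : α) :
    ((M.map Complex.ofReal *ᵥ x) i).re = (M *ᵥ fun j => (x j).re) i := by
  simp [Matrix.mulVec, dotProduct]

theorem im_map_ofReal_mulVec {α β : Type*} [Fintype β] (M : Matrix α β ℝ) (x : β → ℂ) (i : α) :
    ((M.map Complex.ofReal *ᵥ x) i).im = (M *ᵥ fun j => (x j).im) i := by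
  simp [Matrix.mulVec, dotProduct]

/-- `diag d` is a generalized controllability and a generalized observability Gramian of `S`. -/
structure IsBalanced [DecidableEq ι] (S : LinSys ι μ ν) (d : ι → ℝ) : Prop where
  pos : ∀ i, 0 < d i
  ctrl : (-(S.A * Matrix.diagonal d + Matrix.diagonal d * S.Aᵀ + S.B * S.Bᵀ)).PosSemidef
  obs : (-(S.Aᵀ * Matrix.diagonal d + Matrix.diagonal d * S.A + S.Cᵀ * S.C)).PosSemidef

namespace IsBalanced

variable [DecidableEq ι] {S : LinSys ι μ ν} {d : ι → ℝ}

theorem real_obs_le (h : S.IsBalanced d) (x : ι → ℝ) :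
    2 * ∑ i, d i * (x i * (S.A *ᵥ x) i) + ∑ j, (S.C *ᵥ x) j ^ 2 ≤ 0 := by
  have h₁ := h.obs.dotProduct_mulVec_nonneg x
  simp only [star_trivial, Matrix.neg_mulVec, Matrix.add_mulVec, dotProduct_neg, dotProduct_add,
    ← Matrix.mulVec_mulVec] at h₁
  have h₂ : x ⬝ᵥ S.Aᵀ *ᵥ (Matrix.diagonal d *ᵥ x) = ∑ i, d i * (x i * (S.A *ᵥ x) i) := by
    rw [Matrix.dotProduct_mulVec, Matrix.vecMul_transpose]
    simp only [dotProduct, Matrix.mulVec_diagonal]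
    exact Finset.sum_congr rfl fun i _ => by ring
  have h₃ : x ⬝ᵥ Matrix.diagonal d *ᵥ (S.A *ᵥ x) = ∑ i, d i * (x i * (S.A *ᵥ x) i) := by
    simp only [dotProduct, Matrix.mulVec_diagonal]
    exact Finset.sum_congr rfl fun i _ => by ring
  have h₄ : x ⬝ᵥ S.Cᵀ *ᵥ (S.C *ᵥ x) = ∑ j, (S.C *ᵥ x) j ^ 2 := by
    rw [Matrix.dotProduct_mulVec, Matrix.vecMul_transpose]
    simp only [dotProduct, sq]
  linarith

/-- The controllability inequality is tested on `g = diag(d)⁻¹ x`, and the input term is absorbed by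
`2⟨Bᵀg, v⟩ ≤ |Bᵀg|² + |v|²`. -/
theorem real_ctrl_le (h : S.IsBalanced d) (x : ι → ℝ) (v : μ → ℝ) :
    2 * ∑ i, (d i)⁻¹ * (x i * (S.A *ᵥ x + S.B *ᵥ v) i) ≤ ∑ j, v j ^ 2 := by
  set g : ι → ℝ := fun i => (d i)⁻¹ * x i with hg
  have hdg : Matrix.diagonal d *ᵥ g = x := by
    ext i
    rw [Matrix.mulVec_diagonal, hg, mul_inv_cancel_left₀ (h.pos i).ne']
  have h₁ := h.ctrl.dotProduct_mulVec_nonneg g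
  simp only [star_trivial, Matrix.neg_mulVec, Matrix.add_mulVec, dotProduct_neg, dotProduct_add,
    ← Matrix.mulVec_mulVec, hdg] at h₁
  have h₂ : g ⬝ᵥ Matrix.diagonal d *ᵥ (S.Aᵀ *ᵥ g) = g ⬝ᵥ S.A *ᵥ x := by
    rw [Matrix.dotProduct_mulVec, ← Matrix.mulVec_transpose, Matrix.diagonal_transpose, hdg,
      Matrix.dotProduct_mulVec, Matrix.vecMul_transpose, dotProduct_comm]
  have h₃ : g ⬝ᵥ S.B *ᵥ (S.Bᵀ *ᵥ g) = ∑ j, (S.Bᵀ *ᵥ g) j ^ 2 := by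
    rw [Matrix.dotProduct_mulVec, ← Matrix.mulVec_transpose]
    simp only [dotProduct, sq]
  have h₄ : ∑ i, (d i)⁻¹ * (x i * (S.A *ᵥ x + S.B *ᵥ v) i)
      = g ⬝ᵥ S.A *ᵥ x + (S.Bᵀ *ᵥ g) ⬝ᵥ v := by
    rw [Matrix.mulVec_transpose, ← Matrix.dotProduct_mulVec, ← dotProduct_add]
    simp only [dotProduct, hg, mul_assoc]
  have h₅ : 2 * ((S.Bᵀ *ᵥ g) ⬝ᵥ v) ≤ ∑ j, (S.Bᵀ *ᵥ g) j ^ 2 + ∑ j, v j ^ 2 := by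
    rw [dotProduct, Finset.mul_sum, ← Finset.sum_add_distrib]
    exact Finset.sum_le_sum fun j _ => by nlinarith [sq_nonneg ((S.Bᵀ *ᵥ g) j - v j)]
  linarith

/-- The matrices are real, so the real inequalities for the real and imaginary parts add up. -/
theorem obs_le (h : S.IsBalanced d) (x : ι → ℂ) :
    2 * ∑ i, d i * (star (x i) * (S.A.map Complex.ofReal *ᵥ x) i).re +
      ∑ j, ‖(S.C.map Complex.ofReal *ᵥ x) j‖ ^ 2 ≤ 0 := by
  have h₁ := h.real_obs_le fun i => (x i).re
  have h₂ := h.real_obs_le fun i => (x i).im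
  simp only [sq] at h₁ h₂
  simp only [Complex.sq_norm, Complex.normSq_apply, Complex.mul_re, re_map_ofReal_mulVec,
    im_map_ofReal_mulVec, Complex.star_def, Complex.conj_re, Complex.conj_im, mul_add,
    Finset.sum_add_distrib, neg_mul, sub_neg_eq_add]
  linarith

theorem ctrl_le (h : S.IsBalanced d) (x : ι → ℂ) (v : μ → ℂ) :
    2 * ∑ i, (d i)⁻¹ * (star (x i) *
      (S.A.map Complex.ofReal *ᵥ x + S.B.map Complex.ofReal *ᵥ v) i).re ≤ ∑ j, ‖v j‖ ^ 2 := by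
  have h₁ := h.real_ctrl_le (fun i => (x i).re) fun i => (v i).re
  have h₂ := h.real_ctrl_le (fun i => (x i).im) fun i => (v i).im
  simp only [sq, Pi.add_apply, mul_add, Finset.sum_add_distrib] at h₁ h₂
  simp only [Complex.sq_norm, Complex.normSq_apply, Complex.mul_re, re_map_ofReal_mulVec,
    im_map_ofReal_mulVec, Complex.star_def, Complex.conj_re, Complex.conj_im, mul_add,
    Finset.sum_add_distrib, neg_mul, sub_neg_eq_add, Pi.add_apply, Complex.add_re]
  linarith

end IsBalanced

/-! ### Deleting states one at a time -/

/-- `x` is the state at frequency `s`, under the input `u`, of the truncation of `S` to the states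
in `K`, extended by zero. -/
def IsTruncState (S : LinSys ι μ ν) (K : Finset ι) (s : ℂ) (u : μ → ℂ) (x : ι → ℂ) : Prop :=
  (∀ i ∉ K, x i = 0) ∧
    ∀ i ∈ K, s * x i = (S.A.map Complex.ofReal *ᵥ x + S.B.map Complex.ofReal *ᵥ u) i

namespace IsBalanced

variable [DecidableEq ι] {S : LinSys ι μ ν} {d : ι → ℝ}

/-- For a truncated state without input, `obs_le` forces `Re s * ∑ d i ‖x i‖² ≤ 0`. Hence no
truncation, including the intermediate ones, has a pole in the open right half-plane. -/
theorem truncState_zero_input (h : S.IsBalanced d) {s : ℂ} (hs : 0 < s.re) {K : Finset ι}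
    {x : ι → ℂ} (hx : S.IsTruncState K s 0 x) : x = 0 := by
  have h₁ := h.obs_le x
  have h₂ : ∀ i, d i * (star (x i) * (S.A.map Complex.ofReal *ᵥ x) i).re
      = s.re * (d i * ‖x i‖ ^ 2) := by
    intro i
    by_cases hi : i ∈ K
    · have h₃ := hx.2 i hi
      rw [Matrix.mulVec_zero, add_zero] at h₃
      rw [← h₃, Complex.sq_norm, Complex.normSq_apply]
      simp
      ring
    · simp [hx.1 i hi]
  simp only [h₂, ← Finset.mul_sum] at h₁
  have h₄ : 0 ≤ ∑ j, ‖(S.C.map Complex.ofReal *ᵥ x) j‖ ^ 2 := by positivity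
  have h₅ : ∀ i ∈ Finset.univ, 0 ≤ d i * ‖x i‖ ^ 2 := fun i _ =>
    mul_nonneg (h.pos i).le (by positivity)
  have h₆ : ∑ i, d i * ‖x i‖ ^ 2 = 0 :=
    le_antisymm (by nlinarith) (Finset.sum_nonneg h₅)
  ext i
  have h₇ := (Finset.sum_eq_zero_iff_of_nonneg h₅).1 h₆ i (Finset.mem_univ i)
  simpa [(h.pos i).ne'] using h₇

theorem exists_truncState (h : S.IsBalanced d) {s : ℂ} (hs : 0 < s.re) (K : Finset ι)
    (u : μ → ℂ) : ∃ x, S.IsTruncState K s u x := by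
  -- Rows in `K` impose the state equation and the others impose `x i = 0`; injectivity then gives
  -- surjectivity.
  let M : Matrix ι ι ℂ := Matrix.of fun i j =>
    if i ∈ K then S.charMat s i j else (1 : Matrix ι ι ℂ) i j
  have hM : ∀ x i, (M *ᵥ x) i
      = if i ∈ K then s * x i - (S.A.map Complex.ofReal *ᵥ x) i else x i := by
    intro x i
    split_ifs with hi
    · have : (M *ᵥ x) i = (S.charMat s *ᵥ x) i := by simp [Matrix.mulVec, dotProduct, M, hi]
      rw [this]
      simp [charMat, Matrix.sub_mulVec, Matrix.smul_mulVec]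
    · have : (M *ᵥ x) i = ((1 : Matrix ι ι ℂ) *ᵥ x) i := by
        simp [Matrix.mulVec, dotProduct, M, hi]
      rw [this, Matrix.one_mulVec]
  have hinj : Function.Injective M.mulVecLin := by
    refine (injective_iff_map_eq_zero _).2 fun x hx => h.truncState_zero_input hs (K := K) ⟨?_, ?_⟩
    all_goals
      intro i hi
      have := congrFun hx i
      simp only [Matrix.mulVecLin_apply, hM, hi, if_true, if_false, Pi.zero_apply] at this
    · exact this
    · rw [Matrix.mulVec_zero, add_zero]
      exact sub_eq_zero.1 this
  obtain ⟨x, hx⟩ := LinearMap.injective_iff_surjective.1 hinj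
    fun i => if i ∈ K then (S.B.map Complex.ofReal *ᵥ u) i else 0
  refine ⟨x, fun i hi => ?_, fun i hi => ?_⟩
  all_goals
    have := congrFun hx i
    simp only [Matrix.mulVecLin_apply, hM, hi, if_true, if_false] at this
  · exact this
  · rw [Pi.add_apply, ← this]
    ring

/-- Truncating one more state `a` of a balanced system changes the output by at most
`2 d a ‖u‖`. -/
theorem sum_sq_output_sub_le (h : S.IsBalanced d) {s : ℂ} (hs : 0 < s.re) {K : Finset ι} {a : ι}
    (ha : a ∉ K) {u : μ → ℂ} {x z : ι → ℂ} (hx : S.IsTruncState (insert a K) s u x)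
    (hz : S.IsTruncState K s u z) :
    ∑ j, ‖(S.C.map Complex.ofReal *ᵥ (x - z)) j‖ ^ 2 ≤ (2 * d a) ^ 2 * ∑ j, ‖u j‖ ^ 2 := by
  have hobs := h.obs_le (x - z)
  have hctrl := h.ctrl_le (x + z) ((2 : ℂ) • u)
  set A := S.A.map Complex.ofReal
  set B := S.B.map Complex.ofReal
  set w : ℂ := (A *ᵥ z + B *ᵥ u) a
  -- `w` is the residual of the state equation of `z` at the deleted index. Since `z a = 0`, it
  -- enters both inequalities only through `c`, with opposite signs.
  set c : ℝ := (star (x a) * w).re with hc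
  have hza : z a = 0 := hz.1 a ha
  have key : ∀ i, (star ((x - z) i) * (A *ᵥ (x - z)) i).re
        = s.re * ‖(x - z) i‖ ^ 2 - (if i = a then c else 0) ∧
      (star ((x + z) i) * (A *ᵥ (x + z) + B *ᵥ ((2 : ℂ) • u)) i).re
        = s.re * ‖(x + z) i‖ ^ 2 + (if i = a then c else 0) := by
    intro i
    have e₁ : (A *ᵥ (x - z)) i = (A *ᵥ x + B *ᵥ u) i - (A *ᵥ z + B *ᵥ u) i := by
      simp [Matrix.mulVec_sub]
    have e₂ : (A *ᵥ (x + z) + B *ᵥ ((2 : ℂ) • u)) i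
        = (A *ᵥ x + B *ᵥ u) i + (A *ᵥ z + B *ᵥ u) i := by
      simp [Matrix.mulVec_add, Matrix.mulVec_smul]
      ring
    rw [e₁, e₂]
    by_cases hia : i = a
    · subst hia
      rw [← hx.2 i (Finset.mem_insert_self i K), if_pos rfl, hc, Complex.sq_norm,
        Complex.sq_norm, Complex.normSq_apply, Complex.normSq_apply]
      simp only [Pi.sub_apply, Pi.add_apply, hza, sub_zero, add_zero]
      change (star (x i) * (s * x i - w)).re = _ ∧ (star (x i) * (s * x i + w)).re = _
      constructor <;> simp <;> ring
    · rw [if_neg hia]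
      by_cases hi : i ∈ K
      · rw [← hx.2 i (Finset.mem_insert_of_mem hi), ← hz.2 i hi, Complex.sq_norm,
          Complex.sq_norm, Complex.normSq_apply, Complex.normSq_apply]
        constructor <;> simp <;> ring
      · simp [hz.1 i hi, hx.1 i (by simp [hia, hi])]
  simp only [(key _).1, mul_sub, Finset.sum_sub_distrib, mul_ite, mul_zero, Finset.sum_ite_eq',
    Finset.mem_univ, if_true] at hobs
  simp only [(key _).2, mul_add, Finset.sum_add_distrib, mul_ite, mul_zero, Finset.sum_ite_eq',
    Finset.mem_univ, if_true, Pi.smul_apply, norm_smul, mul_pow, ← Finset.mul_sum] at hctrl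
  have h₁ : 0 ≤ ∑ i, d i * (s.re * ‖(x - z) i‖ ^ 2) := Finset.sum_nonneg fun i _ =>
    mul_nonneg (h.pos i).le (by positivity)
  have h₂ : 0 ≤ ∑ i, (d i)⁻¹ * (s.re * ‖(x + z) i‖ ^ 2) := Finset.sum_nonneg fun i _ =>
    mul_nonneg (inv_nonneg.2 (h.pos i).le) (by positivity)
  have h₃ : d a ^ 2 * ((d a)⁻¹ * c) = d a * c := by
    field_simp [(h.pos a).ne']
  have h₄ : ‖(2 : ℂ)‖ ^ 2 = 4 := by norm_num
  rw [h₄] at hctrl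
  have h₅ := mul_le_mul_of_nonneg_left hctrl (sq_nonneg (d a))
  have h₆ := mul_nonneg (sq_nonneg (d a)) h₂
  linarith

theorem norm_output_sub_le (h : S.IsBalanced d) {s : ℂ} (hs : 0 < s.re) {u : μ → ℂ} {x : ι → ℂ}
    (hx : S.IsTruncState Finset.univ s u x) (K : Finset ι) {z : ι → ℂ}
    (hz : S.IsTruncState K s u z) :
    ‖WithLp.toLp 2 (S.C.map Complex.ofReal *ᵥ x - S.C.map Complex.ofReal *ᵥ z)‖
      ≤ 2 * (∑ i ∈ Kᶜ, d i) * ‖WithLp.toLp 2 u‖ := by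
  induction hn : Kᶜ.card generalizing K z with
  | zero =>
    have hK : Kᶜ = ∅ := Finset.card_eq_zero.1 hn
    obtain rfl : K = Finset.univ := by simpa using hK
    have : x - z = 0 := by
      refine h.truncState_zero_input hs (K := Finset.univ) ⟨by simp, fun i hi => ?_⟩
      have h₁ := hx.2 i hi
      have h₂ := hz.2 i hi
      simp only [Pi.add_apply] at h₁ h₂
      simp only [Pi.sub_apply, Pi.add_apply, Matrix.mulVec_sub, Matrix.mulVec_zero, mul_sub,
        Pi.zero_apply, h₁, h₂]
      ring
    rw [← Matrix.mulVec_sub, this]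
    simp
  | succ n ih =>
    obtain ⟨a, ha⟩ : Kᶜ.Nonempty := Finset.card_pos.1 (by omega)
    have haK : a ∉ K := Finset.mem_compl.1 ha
    obtain ⟨y, hy⟩ := h.exists_truncState hs (insert a K) u
    have hcard : (insert a K)ᶜ.card = n := by
      rw [Finset.compl_insert, Finset.card_erase_of_mem ha, hn, Nat.add_sub_cancel]
    have h₁ := ih (insert a K) hy hcard
    have h₂ := h.sum_sq_output_sub_le hs haK hy hz
    have h₃ : ‖WithLp.toLp 2 (S.C.map Complex.ofReal *ᵥ y - S.C.map Complex.ofReal *ᵥ z)‖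
        ≤ 2 * d a * ‖WithLp.toLp 2 u‖ := by
      refine le_of_sq_le_sq ?_ (mul_nonneg (by linarith [h.pos a]) (norm_nonneg _))
      rw [mul_pow, EuclideanSpace.norm_sq_eq, EuclideanSpace.norm_sq_eq, ← Matrix.mulVec_sub]
      exact h₂
    rw [Finset.compl_insert] at h₁
    rw [← Finset.add_sum_erase _ _ ha, ← sub_add_sub_cancel _ (S.C.map Complex.ofReal *ᵥ y),
      WithLp.toLp_add]
    refine (norm_add_le _ _).trans ((add_le_add h₁ h₃).trans (le_of_eq ?_))
    ring

end IsBalanced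

/-! ### Coordinate changes, restrictions and transfer functions -/

/-- The restriction of `S` to the states in the range of `e`. -/
def restrict (S : LinSys ι μ ν) (e : κ → ι) : LinSys κ μ ν where
  A := S.A.submatrix e e
  B := S.B.submatrix e id
  C := S.C.submatrix id e

/-- The system `S` in the coordinates `T x`. -/
noncomputable def coordChange [DecidableEq ι] (S : LinSys ι μ ν) (T : Matrix ι ι ℝ) : LinSys ι μ ν where
  A := T * S.A * T⁻¹
  B := T * S.B
  C := S.C * T⁻¹

theorem map_ofReal_mul {α β γ : Type*} [Fintype β] (M : Matrix α β ℝ) (N : Matrix β γ ℝ) :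
    (M * N).map Complex.ofReal = M.map Complex.ofReal * N.map Complex.ofReal :=
  Matrix.map_mul (f := Complex.ofRealHom)

theorem map_ofReal_mul_eq_one [DecidableEq ι] {M N : Matrix ι ι ℝ} (h : M * N = 1) :
    M.map Complex.ofReal * N.map Complex.ofReal = 1 := by
  rw [← map_ofReal_mul, h]
  exact Matrix.map_one _ Complex.ofReal_zero Complex.ofReal_one

theorem charMat_coordChange {α β : Type*} [DecidableEq ι] (S : LinSys ι α β) {T : Matrix ι ι ℝ}
    (hT : IsUnit T) (s : ℂ) :
    (S.coordChange T).charMat s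
      = T.map Complex.ofReal * S.charMat s * (T⁻¹).map Complex.ofReal := by
  have h := map_ofReal_mul_eq_one
    (Matrix.mul_nonsing_inv T ((Matrix.isUnit_iff_isUnit_det T).1 hT))
  rw [charMat, charMat, coordChange, map_ofReal_mul, map_ofReal_mul, mul_sub, sub_mul, mul_smul_comm, smul_mul_assoc, mul_one,
    h]

theorem transfer_coordChange {α β : Type*} [DecidableEq ι] (S : LinSys ι α β) {T : Matrix ι ι ℝ}
    (hT : IsUnit T) (s : ℂ) : (S.coordChange T).transfer s = S.transfer s := by
  have hdet := (Matrix.isUnit_iff_isUnit_det T).1 hT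
  have h₁ := map_ofReal_mul_eq_one (Matrix.mul_nonsing_inv T hdet)
  have h₂ := map_ofReal_mul_eq_one (Matrix.nonsing_inv_mul T hdet)
  rw [transfer, charMat_coordChange S hT, Matrix.mul_inv_rev, Matrix.mul_inv_rev,
    Matrix.inv_eq_right_inv h₁, Matrix.inv_eq_right_inv h₂]
  simp only [coordChange, transfer, map_ofReal_mul, Matrix.mul_assoc]
  rw [← Matrix.mul_assoc _ (T.map Complex.ofReal) (S.B.map Complex.ofReal), h₂, Matrix.one_mul,
    ← Matrix.mul_assoc _ (T.map Complex.ofReal), h₂, Matrix.one_mul]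

theorem exists_state {β : Type*} [DecidableEq ι] (S : LinSys ι μ β) {s : ℂ} (hs : IsUnit (S.charMat s))
    (u : μ → ℂ) : ∃ x : ι → ℂ,
      S.transfer s *ᵥ u = S.C.map Complex.ofReal *ᵥ x ∧
      ∀ i, s * x i = (S.A.map Complex.ofReal *ᵥ x + S.B.map Complex.ofReal *ᵥ u) i := by
  refine ⟨(S.charMat s)⁻¹ *ᵥ (S.B.map Complex.ofReal *ᵥ u), by simp [transfer, Matrix.mul_assoc], fun i => ?_⟩
  set x := (S.charMat s)⁻¹ *ᵥ (S.B.map Complex.ofReal *ᵥ u) with hx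
  have h : S.charMat s *ᵥ x = S.B.map Complex.ofReal *ᵥ u := by
    rw [hx, Matrix.mulVec_mulVec,
      Matrix.mul_nonsing_inv _ ((Matrix.isUnit_iff_isUnit_det _).1 hs), Matrix.one_mulVec]
  rw [← h, charMat]
  simp [Matrix.sub_mulVec, Matrix.smul_mulVec]

theorem IsBalanced.norm_transfer_sub_restrict_le [DecidableEq ι] [Fintype κ] [DecidableEq κ]
    [DecidableEq μ] {S : LinSys ι μ ν} {d : ι → ℝ} (h : S.IsBalanced d) {e : κ → ι}
    (he : Function.Injective e) {s : ℂ} (hs : 0 < s.re) (h₁ : IsUnit (S.charMat s))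
    (h₂ : IsUnit ((S.restrict e).charMat s)) :
    ‖S.transfer s - (S.restrict e).transfer s‖
      ≤ 2 * ∑ i ∈ (Finset.univ.image e)ᶜ, d i := by
  have hd : 0 ≤ ∑ i ∈ (Finset.univ.image e)ᶜ, d i := Finset.sum_nonneg fun i _ => (h.pos i).le
  rw [Matrix.l2_opNorm_def]
  refine ContinuousLinearMap.opNorm_le_bound _ (by positivity) fun u => ?_
  obtain ⟨x, hxC, hx⟩ := S.exists_state h₁ u.ofLp
  obtain ⟨y, hyC, hy⟩ := (S.restrict e).exists_state h₂ u.ofLp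
  -- Extension by zero turns the state of the restricted system into a truncated state of `S`.
  set z : ι → ℂ := Function.extend e y 0
  have hze : ∀ i, z (e i) = y i := fun i => he.extend_apply _ _ _
  have hz0 : ∀ i, i ∉ Finset.univ.image e → z i = 0 := fun i hi =>
    Function.extend_apply' _ _ _ (by simpa using hi)
  have hsub : ∀ r : ι → ℂ, (fun j => r (e j)) ⬝ᵥ y = r ⬝ᵥ z := by
    intro r
    simp only [dotProduct]
    rw [← Finset.sum_subset (Finset.subset_univ (Finset.univ.image e)),
      Finset.sum_image he.injOn]
    · simp only [hze]
    · intro j _ hj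
      rw [hz0 j hj, mul_zero]
  have hzS : S.IsTruncState (Finset.univ.image e) s u.ofLp z := by
    refine ⟨hz0, fun i hi => ?_⟩
    obtain ⟨j, -, rfl⟩ := Finset.mem_image.1 hi
    rw [hze, hy j, Pi.add_apply, Pi.add_apply]
    exact congrArg (· + _) (hsub (S.A.map Complex.ofReal (e j)))
  have hb := h.norm_output_sub_le hs (x := x) (u := u.ofLp) ⟨by simp, fun i _ => hx i⟩ _ hzS
  have hyz : (S.restrict e).transfer s *ᵥ u.ofLp = S.C.map Complex.ofReal *ᵥ z := by
    rw [hyC]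
    exact funext fun j => hsub (S.C.map Complex.ofReal j)
  rw [← hxC, ← hyz, ← Matrix.sub_mulVec] at hb
  exact hb

/-! ### Congruence of Gramian inequalities and Kronecker structure -/

theorem posSemidef_ctrl_conj {ι : Type*} [Fintype ι] [DecidableEq ι] {M X R T : Matrix ι ι ℝ}
    (hT : IsUnit T) (h : (-(M * X + X * Mᵀ + R)).PosSemidef) :
    (-(T * M * T⁻¹ * (T * X * Tᵀ) + T * X * Tᵀ * (T * M * T⁻¹)ᵀ + T * R * Tᵀ)).PosSemidef := by
  have hdet := (Matrix.isUnit_iff_isUnit_det T).1 hT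
  have h₁ : T⁻¹ * T = 1 := Matrix.nonsing_inv_mul T hdet
  have h₂ : Tᵀ * (T⁻¹)ᵀ = 1 := by rw [← Matrix.transpose_mul, h₁, Matrix.transpose_one]
  have h₃ : T * M * T⁻¹ * (T * X * Tᵀ) + T * X * Tᵀ * (T * M * T⁻¹)ᵀ + T * R * Tᵀ
      = T * (M * X + X * Mᵀ + R) * Tᵀ := by
    have e₁ : T * M * T⁻¹ * (T * X * Tᵀ) = T * M * (T⁻¹ * T) * X * Tᵀ := by
      simp only [Matrix.mul_assoc]
    have e₂ : T * X * Tᵀ * (T * M * T⁻¹)ᵀ = T * X * (Tᵀ * (T⁻¹)ᵀ) * Mᵀ * Tᵀ := by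
      simp only [Matrix.mul_assoc, Matrix.transpose_mul]
    rw [e₁, e₂, h₁, h₂]
    simp only [Matrix.mul_one, Matrix.mul_add, Matrix.add_mul, Matrix.mul_assoc]
  rw [h₃]
  have := h.mul_mul_conjTranspose_same T
  rwa [Matrix.conjTranspose_eq_transpose_of_trivial, Matrix.mul_neg, Matrix.neg_mul] at this

/-- Dual of `posSemidef_ctrl_conj`, with `Mᵀ` and `(T⁻¹)ᵀ` in place of `M` and `T`. -/
theorem posSemidef_obs_conj {ι : Type*} [Fintype ι] [DecidableEq ι] {M Y R T : Matrix ι ι ℝ}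
    (hT : IsUnit T) (h : (-(Mᵀ * Y + Y * M + R)).PosSemidef) :
    (-((T * M * T⁻¹)ᵀ * ((T⁻¹)ᵀ * Y * T⁻¹) + (T⁻¹)ᵀ * Y * T⁻¹ * (T * M * T⁻¹)
      + (T⁻¹)ᵀ * R * T⁻¹)).PosSemidef := by
  have hdet := (Matrix.isUnit_iff_isUnit_det T).1 hT
  have hU : IsUnit (T⁻¹)ᵀ := by
    rw [Matrix.isUnit_iff_isUnit_det, Matrix.det_transpose]
    exact Matrix.isUnit_nonsing_inv_det T hdet
  have hinv : ((T⁻¹)ᵀ)⁻¹ = Tᵀ := by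
    rw [← Matrix.transpose_nonsing_inv, Matrix.nonsing_inv_nonsing_inv T hdet]
  have := posSemidef_ctrl_conj (M := Mᵀ) (X := Y) (R := R) hU (by simpa using h)
  rw [hinv] at this
  simpa [Matrix.transpose_mul, Matrix.mul_assoc] using this

theorem posSemidef_kronecker_add {ι δ : Type*} [Fintype ι] [Fintype δ] {P Q : Matrix ι ι ℝ}
    {R S : Matrix δ δ ℝ} (hP : P.PosSemidef) (hR : R.PosSemidef) (hQ : Q.PosSemidef)
    (hS : S.PosSemidef) : (P ⊗ₖ R + Q ⊗ₖ S).PosSemidef :=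
  (hP.kronecker hR).add (hQ.kronecker hS)

/-- The Kronecker product of the Gramians of a network triplet and of a passive agent is balanced
for the networked system. -/
theorem networked_isBalanced {ι δ π ο μ : Type*} [Fintype ι] [DecidableEq ι] [Fintype δ]
    [DecidableEq δ] [Fintype π] [Fintype ο] [Fintype μ] {G : LinSys ι π ο} {D : LinSys δ μ μ}
    {σ : ι → ℝ} {τ : δ → ℝ} (hσ : ∀ i, 0 < σ i) (hτ : ∀ j, 0 < τ j)
    (hGc : (-(-G.A * Matrix.diagonal σ + Matrix.diagonal σ * (-G.A)ᵀ + G.B * G.Bᵀ)).PosSemidef)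
    (hGo : (-((-G.A)ᵀ * Matrix.diagonal σ + Matrix.diagonal σ * -G.A + G.Cᵀ * G.C)).PosSemidef)
    (hDc : (-(D.A * Matrix.diagonal τ + Matrix.diagonal τ * D.Aᵀ)).PosSemidef)
    (hDo : (-(D.Aᵀ * Matrix.diagonal τ + Matrix.diagonal τ * D.A)).PosSemidef)
    (hCc : D.C * Matrix.diagonal τ = D.Bᵀ) (hCo : D.C = D.Bᵀ * Matrix.diagonal τ) :
    (G.networked D).IsBalanced fun p => σ p.1 * τ p.2 := by
  have hdiag : Matrix.diagonal (fun p : ι × δ => σ p.1 * τ p.2)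
      = Matrix.diagonal σ ⊗ₖ Matrix.diagonal τ :=
    (Matrix.diagonal_kronecker_diagonal σ τ).symm
  have hσs : (Matrix.diagonal σ).PosSemidef := Matrix.PosSemidef.diagonal fun i => (hσ i).le
  refine ⟨fun p => mul_pos (hσ _) (hτ _), ?_, ?_⟩
  · have hB : (D.B * D.Bᵀ).PosSemidef := by
      simpa [Matrix.conjTranspose_eq_transpose_of_trivial] using
        Matrix.posSemidef_self_mul_conjTranspose D.B
    have hCc' : Matrix.diagonal τ * D.Cᵀ = D.B := by
      simpa using congrArg Matrix.transpose hCc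
    -- The negated Lyapunov expression splits as `diag σ` ⊗ (agent part) + (network part) ⊗ `B Bᵀ`.
    have h := posSemidef_kronecker_add hσs hDc hGc hB
    convert h using 1
    have e₁ : D.B * D.C * Matrix.diagonal τ = D.B * D.Bᵀ := by rw [Matrix.mul_assoc, hCc]
    have e₂ : Matrix.diagonal τ * (D.B * D.C)ᵀ = D.B * D.Bᵀ := by
      rw [Matrix.transpose_mul, ← Matrix.mul_assoc, hCc']
    simp only [networked, hdiag, Matrix.transpose_sub, ← Matrix.kroneckerMap_transpose,
      Matrix.sub_mul, Matrix.mul_sub, ← Matrix.mul_kronecker_mul, e₁, e₂, Matrix.transpose_one,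
      Matrix.one_mul, Matrix.mul_one]
    ext ⟨i, j⟩ ⟨i', j'⟩
    simp only [Matrix.add_apply, Matrix.sub_apply, Matrix.neg_apply, Matrix.kroneckerMap_apply,
      Matrix.neg_mul, Matrix.mul_neg, Matrix.transpose_neg]
    ring
  · have hC : (D.Cᵀ * D.C).PosSemidef := by
      simpa [Matrix.conjTranspose_eq_transpose_of_trivial] using
        Matrix.posSemidef_conjTranspose_mul_self D.C
    have hCo' : Matrix.diagonal τ * D.B = D.Cᵀ := by
      simpa using (congrArg Matrix.transpose hCo).symm
    have h := posSemidef_kronecker_add hσs hDo hGo hC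
    convert h using 1
    have e₁ : (D.B * D.C)ᵀ * Matrix.diagonal τ = D.Cᵀ * D.C := by
      rw [Matrix.transpose_mul, Matrix.mul_assoc, ← hCo]
    have e₂ : Matrix.diagonal τ * (D.B * D.C) = D.Cᵀ * D.C := by
      rw [← Matrix.mul_assoc, hCo']
    simp only [networked, hdiag, Matrix.transpose_sub, ← Matrix.kroneckerMap_transpose,
      Matrix.sub_mul, Matrix.mul_sub, ← Matrix.mul_kronecker_mul, e₁, e₂, Matrix.transpose_one,
      Matrix.one_mul, Matrix.mul_one]
    ext ⟨i, j⟩ ⟨i', j'⟩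
    simp only [Matrix.add_apply, Matrix.sub_apply, Matrix.neg_apply, Matrix.kroneckerMap_apply,
      Matrix.neg_mul, Matrix.mul_neg, Matrix.transpose_neg]
    ring

theorem networked_coordChange {ι δ π ο μ : Type*} [Fintype ι] [DecidableEq ι] [Fintype δ]
    [DecidableEq δ] [Fintype μ] (G : LinSys ι π ο) (D : LinSys δ μ μ) {T : Matrix ι ι ℝ}
    (hT : IsUnit T) (U : Matrix δ δ ℝ) :
    (G.coordChange T).networked (D.coordChange U) = (G.networked D).coordChange (T ⊗ₖ U) := by
  have h₁ : T * T⁻¹ = 1 := Matrix.mul_nonsing_inv T ((Matrix.isUnit_iff_isUnit_det T).1 hT)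
  simp only [networked, coordChange, Matrix.inv_kronecker, Matrix.mul_sub, Matrix.sub_mul,
    ← Matrix.mul_kronecker_mul, Matrix.mul_one, h₁, Matrix.mul_assoc]

theorem networked_restrict {ι δ κ η π ο μ : Type*} [Fintype ι] [DecidableEq ι] [Fintype δ]
    [DecidableEq δ] [DecidableEq κ] [Fintype μ] (G : LinSys ι π ο) (D : LinSys δ μ μ) {e : κ → ι}
    (he : Function.Injective e) (f : η → δ) :
    (G.restrict e).networked (D.restrict f) = (G.networked D).restrict (Prod.map e f) := by
  have h₁ : (1 : Matrix κ κ ℝ) = (1 : Matrix ι ι ℝ).submatrix e e :=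
    (Matrix.submatrix_one e he).symm
  simp only [networked, restrict, h₁]
  rfl

theorem truncate_eq_restrict {d l : ℕ} {μ ν : Type*} (S : LinSys (Fin d) μ ν)
    (T : Matrix (Fin d) (Fin d) ℝ) (hl : l ≤ d) :
    S.truncate T hl = (S.coordChange T).restrict (Fin.castLE hl) := rfl

end LinSys

/-! ### The a priori error bound -/

theorem IsBalancing.pos {d : ℕ} {T P Q : Matrix (Fin d) (Fin d) ℝ} {σ : Fin d → ℝ}
    (h : IsBalancing T P Q σ) (hP : P.PosDef) (i : Fin d) : 0 < σ i := by
  have h₁ : (T * P * Tᵀ).PosDef := by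
    have := (Matrix.IsUnit.posDef_star_right_conjugate_iff (x := P) h.1).2 hP
    rwa [Matrix.star_eq_conjTranspose, Matrix.conjTranspose_eq_transpose_of_trivial] at this
  rw [h.2.1] at h₁
  exact Matrix.posDef_diagonal_iff.1 h₁ i

theorem two_mul_sum_compl_image_castLE {M n k r : ℕ} (hk : 1 ≤ k) (hkM : k - 1 ≤ M) (hr : r ≤ n)
    (σ : Fin M → ℝ) (τ : Fin n → ℝ) :
    2 * ∑ x ∈ (Finset.univ.image (Prod.map (Fin.castLE hkM) (Fin.castLE hr)))ᶜ, σ x.1 * τ x.2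
      = errBound k r σ τ := by
  have h : (Finset.univ.image (Prod.map (Fin.castLE hkM) (Fin.castLE hr)))ᶜ
      = Finset.univ.filter fun x : Fin M × Fin n => k ≤ x.1.val + 1 ∨ r < x.2.val + 1 := by
    ext ⟨i, j⟩
    rw [Finset.mem_compl, Finset.mem_filter, ← not_iff_not]
    simp only [Finset.mem_image, Finset.mem_univ, true_and, not_not, not_or, not_le, not_lt,
      Prod.exists, Prod.map_apply, Prod.mk.injEq]
    constructor
    · rintro ⟨a, b, rfl, rfl⟩
      have := a.2
      have := b.2
      simp only [Fin.val_castLE]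
      omega
    · rintro ⟨h₁, h₂⟩
      exact ⟨⟨i, by omega⟩, ⟨j, by omega⟩, rfl, rfl⟩
  rw [h, errBound, ← mul_add, Finset.sum_filter, Fintype.sum_prod_type, Finset.sum_filter,
    Finset.sum_filter, ← Finset.sum_add_distrib]
  congr 1
  refine Finset.sum_congr rfl fun i _ => ?_
  by_cases hi : k ≤ i.val + 1
  · simp [hi]
  · simp [hi, not_le.1 hi, Finset.sum_filter]

open scoped MatrixOrder in
theorem mainTheorem3 {N n m p q k r : ℕ} (hk : 1 ≤ k) (hkN : k ≤ N) (hr : r ≤ n)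
    -- the network: graph weights, input and output matrices
    (w : Fin N → Fin N → ℝ) (hw : IsConnectedWeight w)
    (F : Matrix (Fin N) (Fin p) ℝ) (H : Matrix (Fin q) (Fin N) ℝ)
    -- the agent `(A, B, C)`, with the extremal solutions of its passivity inequality
    (D : LinSys (Fin n) (Fin m) (Fin m)) (hD : D.IsMinimal)
    (Km KM : Matrix (Fin n) (Fin n) ℝ)
    (hKm : IsLeast D.kypSolutions Km) (hKM : IsGreatest D.kypSolutions KM)
    -- the spectral decomposition of the Laplacian
    (T₁ : Matrix (Fin N) (Fin (N - 1)) ℝ) (lam : Fin (N - 1) → ℝ)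
    (hT : IsSpectralDecomp (weightedLaplacian w) T₁ lam)
    -- the network Gramians
    (X Y : Matrix (Fin (N - 1)) (Fin (N - 1)) ℝ) (hX : X.PosDef) (hY : Y.PosDef)
    (hXeq : -(Matrix.diagonal lam * X) - X * Matrix.diagonal lam +
      (T₁ᵀ * F) * (T₁ᵀ * F)ᵀ = 0)
    (hYle : (-(-(Matrix.diagonal lam * Y) - Y * Matrix.diagonal lam +
      (H * T₁)ᵀ * (H * T₁))).PosSemidef)
    (hYblk : IsBlockDiagAlong lam Y)
    -- the balancing transformations and the generalized Hankel singular values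
    (TG : Matrix (Fin (N - 1)) (Fin (N - 1)) ℝ) (σ : Fin (N - 1) → ℝ)
    (hTG : IsBalancing TG X Y σ)
    (TD : Matrix (Fin n) (Fin n) ℝ) (τ : Fin n → ℝ)
    (hTD : IsBalancing TD KM⁻¹ Km τ) :
    (((stableTriplet T₁ lam F H).networked D).sub
      (((stableTriplet T₁ lam F H).truncate TG (Nat.sub_le_sub_right hkN 1)).networked
        (D.truncate TD hr))).hinfNorm ≤ ENNReal.ofReal (errBound k r σ τ) := by
  obtain ⟨hMpos, hMly, hMC⟩ := hKM.1
  obtain ⟨-, hmly, hmC⟩ := hKm.1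
  have hGdet := (Matrix.isUnit_iff_isUnit_det TG).1 hTG.1
  have hDdet := (Matrix.isUnit_iff_isUnit_det TD).1 hTD.1
  have hMdet := (Matrix.isUnit_iff_isUnit_det KM).1 hMpos.isUnit
  have hMT : KMᵀ = KM := by
    simpa [Matrix.conjTranspose_eq_transpose_of_trivial] using hMpos.isHermitian.eq
  have hMiT : (KM⁻¹)ᵀ = KM⁻¹ := by rw [Matrix.transpose_nonsing_inv, hMT]
  have hbal : (((stableTriplet T₁ lam F H).coordChange TG).networked
      (D.coordChange TD)).IsBalanced fun x => σ x.1 * τ x.2 := by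
    refine LinSys.networked_isBalanced (hTG.pos hX) (hTD.pos hMpos.inv) ?_ ?_ ?_ ?_ ?_ ?_
    · have h := LinSys.posSemidef_ctrl_conj (M := -Matrix.diagonal lam) (X := X)
        (R := (T₁ᵀ * F) * (T₁ᵀ * F)ᵀ) hTG.1 (by
          rw [Matrix.transpose_neg, Matrix.diagonal_transpose, Matrix.neg_mul, Matrix.mul_neg,
            ← sub_eq_add_neg, hXeq, neg_zero]
          exact Matrix.PosSemidef.zero)
      rw [hTG.2.1] at h
      simpa [stableTriplet, LinSys.coordChange, Matrix.transpose_mul, Matrix.mul_assoc,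
        -Matrix.diagonal_neg] using h
    · have h := LinSys.posSemidef_obs_conj (M := -Matrix.diagonal lam) (Y := Y)
        (R := (H * T₁)ᵀ * (H * T₁)) hTG.1 (by
          rwa [Matrix.transpose_neg, Matrix.diagonal_transpose, Matrix.neg_mul, Matrix.mul_neg,
            ← sub_eq_add_neg])
      rw [hTG.2.2.1] at h
      simpa [stableTriplet, LinSys.coordChange, Matrix.transpose_mul, Matrix.mul_assoc,
        -Matrix.diagonal_neg] using h
    -- Congruence of the passivity inequality for `KM` by `KM⁻¹` yields the controllability-type
    -- inequality.
    · have h := LinSys.posSemidef_ctrl_conj (M := D.A) (X := KM⁻¹) (R := 0) hTD.1 (by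
          have h₁ := hMly.mul_mul_conjTranspose_same KM⁻¹
          rw [Matrix.conjTranspose_eq_transpose_of_trivial, hMiT] at h₁
          have h₂ : KM⁻¹ * -(D.Aᵀ * KM + KM * D.A) * KM⁻¹
              = -(D.A * KM⁻¹ + KM⁻¹ * D.Aᵀ + 0) := by
            rw [Matrix.mul_neg, Matrix.neg_mul, Matrix.mul_add, Matrix.add_mul, Matrix.mul_assoc,
              Matrix.mul_assoc, Matrix.mul_nonsing_inv _ hMdet, Matrix.mul_one,
              ← Matrix.mul_assoc KM⁻¹ KM, Matrix.nonsing_inv_mul _ hMdet, Matrix.one_mul,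
              add_zero, add_comm]
          rwa [h₂] at h₁)
      rw [hTD.2.1, Matrix.mul_zero, Matrix.zero_mul, add_zero] at h
      exact h
    · have h := LinSys.posSemidef_obs_conj (M := D.A) (Y := Km) (R := 0) hTD.1
        (by rwa [add_zero])
      rw [hTD.2.2.1, Matrix.mul_zero, Matrix.zero_mul, add_zero] at h
      exact h
    -- `C = Bᵀ KM` gives `C KM⁻¹ = Bᵀ`, which the balancing carries to the new coordinates.
    · rw [← hTD.2.1]
      simp only [LinSys.coordChange, Matrix.transpose_mul, Matrix.mul_assoc]
      rw [← Matrix.mul_assoc TD⁻¹, Matrix.nonsing_inv_mul _ hDdet, Matrix.one_mul, hMC,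
        Matrix.mul_assoc, ← Matrix.mul_assoc KM, Matrix.mul_nonsing_inv _ hMdet, Matrix.one_mul]
    · have h : TDᵀ * (TD⁻¹)ᵀ = 1 := by
        rw [← Matrix.transpose_mul, Matrix.nonsing_inv_mul _ hDdet, Matrix.transpose_one]
      rw [← hTD.2.2.1]
      simp only [LinSys.coordChange, Matrix.transpose_mul, Matrix.mul_assoc]
      rw [← Matrix.mul_assoc TDᵀ, h, Matrix.one_mul, hmC, Matrix.mul_assoc]
  have hU : IsUnit (TG ⊗ₖ TD) := by
    rw [Matrix.isUnit_iff_isUnit_det, Matrix.det_kronecker]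
    exact (hGdet.pow _).mul (hDdet.pow _)
  have hinj := Fin.castLE_injective (Nat.sub_le_sub_right hkN 1)
  refine iSup_le fun s => iSup_le fun hs => iSup_le fun hchar => ?_
  rw [LinSys.charMat_sub, Matrix.isUnit_fromBlocks_zero₂₁] at hchar
  obtain ⟨h₁, h₂⟩ := hchar
  rw [LinSys.transfer_sub _ _ s h₁ h₂]
  -- Only the full system changes coordinates; the reduced one is already a restriction of the
  -- balanced realization.
  rw [← LinSys.transfer_coordChange _ hU]
  have h₁' : IsUnit ((((stableTriplet T₁ lam F H).networked D).coordChange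
      (TG ⊗ₖ TD)).charMat s) := by
    rw [LinSys.charMat_coordChange _ hU]
    have hmap := LinSys.map_ofReal_mul_eq_one
      (Matrix.mul_nonsing_inv _ ((Matrix.isUnit_iff_isUnit_det _).1 hU))
    exact ((IsUnit.of_mul_eq_one _ hmap).mul h₁).mul (IsUnit.of_mul_eq_one_right _ hmap)
  rw [← LinSys.networked_coordChange _ _ hTG.1] at h₁' ⊢
  rw [LinSys.truncate_eq_restrict, LinSys.truncate_eq_restrict,
    LinSys.networked_restrict _ _ hinj] at h₂ ⊢
  rw [← two_mul_sum_compl_image_castLE hk (Nat.sub_le_sub_right hkN 1) hr, ← ofReal_norm]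
  exact ENNReal.ofReal_le_ofReal
    (hbal.norm_transfer_sub_restrict_le (hinj.prodMap (Fin.castLE_injective hr)) hs h₁' h₂)
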